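/- Let $\mathcal N=\mathbb N^{\mathbb N}$ be the Baire space (with $0\in\mathbb N$ and the product topology), and for $\sigma\ne\tau$ in $\mathcal N$ put $d(\sigma,\tau)=2^{-(\min\{n:\sigma_n\neq\tau_n\}-1)}$. Let $\prec$ be a well order of $\mathcal N$ and let $$K=\{x\in[0,1]^{\mathcal N} : x_\sigma\le x_\tau+d(\sigma,\tau)\text{ whenever }\sigma\prec\tau\}$$ be the compact space of almost increasing functions associated to $\prec$, with the topology of pointwise convergence. Call a compact Hausdorff space $L$ an RN compactum if there is a lower semicontinuous metric $\rho:L\times L\to\mathbb R$ that fragments $L$, i.e. such that for every $\varepsilon>0$ every nonempty closed subset of $L$ has a nonempty relatively open subset of $\rho$-diameter less than $\varepsilon$ (equivalently, $L$ is homeomorphic to a weak$^*$ compact subset of a dual Banach space with the Radon-Nikodým property). An RN quotient of $K$ is an RN compactum that is a topological quotient of $K$, and the weight of a space is the least cardinality of a base of its topology. Then: 1. For every infinite cardinal $\lambda<\mathfrak c$, $K$ has an RN quotient of weight $\lambda$. 2. If $\mathfrak c$ is a regular cardinal, then $K$ has an RN quotient of weight $\mathfrak c$. 3. If every infinite $\prec$-interval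 is dense in $\mathcal N$, then $K$ has an RN quotient of weight $\mathfrak c$. -/

import Mathlib

open Cardinal Topology

/-- The distance `d(σ, τ) = 1 / 2 ^ (min {n | σ n ≠ τ n} - 1)` on the Baire space `ℕ → ℕ`
(indices start at `0`, so the distance of two sequences with `σ 0 ≠ τ 0` is `2`). -/
noncomputable def baireDist (σ τ : ℕ → ℕ) : ℝ :=
  open Classical in
  if σ = τ then 0 else 1 / (2 : ℝ) ^ (((sInf {n : ℕ | σ n ≠ τ n} : ℕ) : ℤ) - 1)

/-- The almost increasing functions from the Baire space to `[0,1]`, with respect to the strict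
order `r`; as a subset of the power `(ℕ → ℕ) → ℝ`, it carries the topology of pointwise
convergence. -/
def almostIncreasing (r : (ℕ → ℕ) → (ℕ → ℕ) → Prop) : Set ((ℕ → ℕ) → ℝ) :=
  {x | (∀ σ, x σ ∈ Set.Icc (0 : ℝ) 1) ∧ ∀ σ τ, r σ τ → x σ ≤ x τ + baireDist σ τ}

/-- `d` fragments `X`: for every `ε > 0`, every nonempty subset of `X` has a nonempty relatively
open subset whose `d`-diameter is less than `ε`. -/
def Fragments {X : Type*} [TopologicalSpace X] (d : X → X → ℝ) : Prop :=
  ∀ ε > 0, ∀ A : Set X, A.Nonempty → ∃ U : Set X, IsOpen U ∧ (A ∩ U).Nonempty ∧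
    ∃ δ < ε, ∀ x ∈ A ∩ U, ∀ y ∈ A ∩ U, d x y ≤ δ

/-- `d` is a metric on the set `X` (not required to be compatible with a topology). -/
structure IsMetricOn {X : Type*} (d : X → X → ℝ) : Prop where
  eq_zero_iff : ∀ x y, d x y = 0 ↔ x = y
  symm : ∀ x y, d x y = d y x
  triangle : ∀ x y z, d x z ≤ d x y + d y z

/-- Radon-Nikodym compact spaces: compact Hausdorff spaces that are fragmented by a lower
semicontinuous metric. -/
def IsRNCompact (X : Type*) [TopologicalSpace X] : Prop :=
  CompactSpace X ∧ T2Space X ∧ ∃ d : X → X → ℝ, IsMetricOn d ∧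
    LowerSemicontinuous (fun p : X × X => d p.1 p.2) ∧ Fragments d

/-- The weight of a topological space: the least cardinality of a base. -/
noncomputable def topWeight (X : Type) [TopologicalSpace X] : Cardinal.{0} :=
  sInf {κ | ∃ B : Set (Set X), TopologicalSpace.IsTopologicalBasis B ∧ #B = κ}

/-- `X` has an RN compact quotient of weight `κ`. -/
def HasRNQuotientOfWeight (X : Type) [TopologicalSpace X] (κ : Cardinal.{0}) : Prop :=
  ∃ (L : Type) (_ : TopologicalSpace L) (q : X → L),
    IsQuotientMap q ∧ IsRNCompact L ∧ topWeight L = κ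

/-! For any infinite `κ ≤ 𝔠`, restrict the almost increasing functions to a set `S` of `κ` binary
sequences. The Cantor space is totally bounded for `baireDist`: prefixes of length `n` split `S`
into finitely many pieces of small diameter, so on each piece all functions increase along the well
order up to a small error. Taking the least index where a threshold is exceeded then yields
fragmentation by the uniform metric (`exists_open_threshold`, `exists_open_uniform_oscillation`).
The weight is at most `κ` since the quotient lies in `ℝ^S`, and at least `κ` since step functions
along the order are separated. -/

open TopologicalSpace in
/-- A space whose topology is induced by an infinite family of real functions has weight at most
the size of the family. -/
theorem topWeight_le_of_isInducing {X ι : Type} [TopologicalSpace X] [Infinite ι]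
    {F : X → ι → ℝ} (hF : IsInducing F) : topWeight X ≤ #ι := by
  let s : ι × countableBasis ℝ → Set X := fun p => (fun x => F x p.1) ⁻¹' p.2.1
  have hgen : (inferInstance : TopologicalSpace X) = generateFrom (Set.range s) := by
    rw [hF.eq_induced, induced_to_pi]
    have hs : Set.range s = ⋃ i, Set.preimage (fun x => F x i) '' countableBasis ℝ := by
      ext U
      simp only [Set.mem_range, Prod.exists, Subtype.exists, Set.mem_iUnion, Set.mem_image, s,
        exists_prop]
    rw [hs, generateFrom_iUnion]
    refine iInf_congr fun i => ?_
    exact (congrArg (induced fun x => F x i) (isBasis_countableBasis ℝ).eq_generateFrom).trans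
      induced_generateFrom_eq
  have hbasis := isTopologicalBasis_of_subbasis hgen
  have hle : topWeight X ≤ _ := csInf_le' ⟨_, hbasis, rfl⟩
  refine hle.trans ?_
  let g : Finset (ι × countableBasis ℝ) → Set X := fun G => ⋂₀ (s '' G)
  have hsub : ((fun f => ⋂₀ f) '' {f : Set (Set X) | f.Finite ∧ f ⊆ Set.range s}) ⊆
      Set.range g := by
    rintro _ ⟨f, ⟨hfin, hf⟩, rfl⟩
    rw [← Set.image_univ] at hf
    -- `s` need not be injective: one index is chosen per member of `f`, so that `G` inherits
    -- finiteness from `f`.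
    obtain ⟨G, -, hG⟩ := Set.exists_subset_bijOn (Set.univ ∩ s ⁻¹' f) s
    have hG' : s '' G = f := by
      rw [hG.image_eq]
      ext U
      constructor
      · rintro ⟨p, hp, rfl⟩
        exact hp.2
      · intro hU
        obtain ⟨p, -, rfl⟩ := hf hU
        exact ⟨p, ⟨trivial, hU⟩, rfl⟩
    have hGfin : G.Finite := Set.Finite.of_finite_image (hG' ▸ hfin) hG.injOn
    refine ⟨hGfin.toFinset, ?_⟩
    simp only [g, Set.Finite.coe_toFinset, hG']
  calc _ ≤ #(Set.range g) := mk_le_mk_of_subset hsub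
    _ ≤ #(Finset (ι × countableBasis ℝ)) := mk_range_le
    _ = #(ι × countableBasis ℝ) := by
      obtain ⟨V, hV, -⟩ :=
        (isBasis_countableBasis ℝ).exists_subset_of_mem_open (Set.mem_univ 0) isOpen_univ
      have : Nonempty (countableBasis ℝ) := ⟨⟨V, hV⟩⟩
      exact mk_finset_of_infinite _
    _ = #ι * #(countableBasis ℝ) := by simp
    _ ≤ #ι * ℵ₀ := by
      gcongr
      exact (countable_countableBasis ℝ).le_aleph0
    _ = #ι := mul_aleph0_eq (aleph0_le_mk ι)

/-- A lower bound for the weight: a left-separated family of points. -/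
theorem le_topWeight_of_separated {X ι : Type} [TopologicalSpace X] (p : ι → X) (U : ι → Set X)
    (hU : ∀ i, IsOpen (U i)) (hp : ∀ i, p i ∈ U i)
    (hsep : ∀ i j, i ≠ j → p i ∉ U j ∨ p j ∉ U i) : #ι ≤ topWeight X := by
  refine le_csInf ⟨_, _, TopologicalSpace.isTopologicalBasis_opens, rfl⟩ ?_
  rintro _ ⟨B, hB, rfl⟩
  choose V hVB hpV hVU using fun i => hB.exists_subset_of_mem_open (hp i) (hU i)
  refine mk_le_of_injective (f := fun i => (⟨V i, hVB i⟩ : B)) fun i j hij => ?_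
  have hij : V i = V j := congrArg Subtype.val hij
  by_contra hne
  rcases hsep i j hne with h | h
  · exact h (hVU j (hij ▸ hpV i))
  · exact h (hVU i (hij ▸ hpV j))

/-! ### Fragmentation from well-ordered families -/

/-- Finitely many relations, each of which holds on some relatively open piece of every nonempty
set, hold simultaneously on such pieces. -/
theorem exists_open_forall_finset {X J : Type*} [TopologicalSpace X] (R : J → X → X → Prop)
    (hR : ∀ j, ∀ Z : Set X, Z.Nonempty → ∃ U, IsOpen U ∧ (Z ∩ U).Nonempty ∧
      ∀ x ∈ Z ∩ U, ∀ y ∈ Z ∩ U, R j x y)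
    (s : Finset J) (Z : Set X) (hZ : Z.Nonempty) : ∃ U, IsOpen U ∧ (Z ∩ U).Nonempty ∧
      ∀ j ∈ s, ∀ x ∈ Z ∩ U, ∀ y ∈ Z ∩ U, R j x y := by
  classical
  induction s using Finset.induction_on with
  | empty => exact ⟨Set.univ, isOpen_univ, by simpa using hZ, by simp⟩
  | insert j s _ ih =>
    obtain ⟨U, hUo, hU, hUR⟩ := ih
    obtain ⟨V, hVo, hV, hVR⟩ := hR j _ hU
    refine ⟨U ∩ V, hUo.inter hVo, by rwa [← Set.inter_assoc], fun i hi x hx y hy => ?_⟩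
    rw [← Set.inter_assoc] at hx hy
    rcases Finset.mem_insert.1 hi with rfl | hi
    · exact hVR x hx y hy
    · exact hUR i hi x hx.1 y hy.1

/-- Consider continuous functions indexed by a well-ordered set, increasing in the index up to an
error `ε`. Minimising the index at which the threshold `c` is exceeded, one finds a relatively open
set on which the functions cross `c` essentially at the same index. -/
theorem exists_open_threshold {X I : Type*} [TopologicalSpace X] (r : I → I → Prop)
    [IsWellOrder I r] (F : I → X → ℝ) (P : Set I) (hF : ∀ i, Continuous (F i)) (ε : ℝ) (hε : 0 ≤ ε)
    (hinc : ∀ x, ∀ σ ∈ P, ∀ τ ∈ P, r σ τ → F σ x ≤ F τ x + ε) (c : ℝ)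
    (Z : Set X) (hZ : Z.Nonempty) : ∃ U, IsOpen U ∧ (Z ∩ U).Nonempty ∧
      ∀ x ∈ Z ∩ U, ∀ y ∈ Z ∩ U, ∀ σ ∈ P, c < F σ x → c - ε ≤ F σ y := by
  by_cases hex : ∃ σ, σ ∈ P ∧ ∃ x ∈ Z, c < F σ x
  · have wf : WellFounded r := IsWellFounded.wf
    obtain ⟨hmP, x₀, hx₀, hcx₀⟩ := wf.min_mem {σ | σ ∈ P ∧ ∃ x ∈ Z, c < F σ x} hex
    set m := wf.min {σ | σ ∈ P ∧ ∃ x ∈ Z, c < F σ x} hex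
    refine ⟨{x | c < F m x}, isOpen_lt continuous_const (hF m), ⟨x₀, hx₀, hcx₀⟩,
      fun x hx y hy σ hσ hc => ?_⟩
    have hy' : c < F m y := hy.2
    -- An index exceeding `c` anywhere on `Z` cannot precede `m`, so at `y` its value is at least `F
    -- m y - ε > c - ε`.
    have hnot : ¬ r σ m := wf.not_lt_min {σ | σ ∈ P ∧ ∃ x ∈ Z, c < F σ x} ⟨hσ, x, hx.1, hc⟩
    rcases trichotomous_of r σ m with h | rfl | h
    · exact absurd h hnot
    · linarith
    · linarith [hinc y m hmP σ hσ h]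
  · push Not at hex
    exact ⟨Set.univ, isOpen_univ, by simpa using hZ, fun x hx y _ σ hσ hc =>
      absurd hc (not_lt.2 (hex σ hσ x hx.1))⟩

/-- Uniformly bounded continuous functions on `X` that split into finitely many well-ordered
families, each increasing in the index up to an error `ε`, have uniform oscillation at most `2 ε`
on some relatively open piece of every nonempty set. -/
theorem exists_open_uniform_oscillation {X I J : Type*} [TopologicalSpace X] [Finite J]
    (r : I → I → Prop) [IsWellOrder I r] (F : I → X → ℝ) (hF : ∀ i, Continuous (F i))
    (h01 : ∀ i x, F i x ∈ Set.Icc (0 : ℝ) 1) (π : I → J) (ε : ℝ) (hε : 0 < ε)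
    (hinc : ∀ x σ τ, π σ = π τ → r σ τ → F σ x ≤ F τ x + ε)
    (Z : Set X) (hZ : Z.Nonempty) : ∃ U, IsOpen U ∧ (Z ∩ U).Nonempty ∧
      ∀ x ∈ Z ∩ U, ∀ y ∈ Z ∩ U, ∀ i, |F i x - F i y| ≤ 2 * ε := by
  have := Fintype.ofFinite J
  -- The thresholds `k * ε` with `k < m` form an `ε`-grid of `[0,1]`.
  obtain ⟨m, hm⟩ := exists_nat_gt (1 / ε)
  obtain ⟨U, hUo, hU, hUR⟩ := exists_open_forall_finset
    (fun (p : J × ℕ) x y => ∀ σ ∈ π ⁻¹' {p.1}, p.2 * ε < F σ x → p.2 * ε - ε ≤ F σ y)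
    (fun p => exists_open_threshold r F (π ⁻¹' {p.1}) hF ε hε.le
      (fun x σ hσ τ hτ => hinc x σ τ (hσ.trans hτ.symm)) (p.2 * ε))
    (Finset.univ ×ˢ Finset.range m) Z hZ
  have key : ∀ x ∈ Z ∩ U, ∀ y ∈ Z ∩ U, ∀ i, F i x - F i y ≤ 2 * ε := by
    intro x hx y hy i
    rcases (h01 i x).1.eq_or_lt with h0 | h0
    · linarith [(h01 i y).1]
    -- The ceiling gives `k * ε < F i x ≤ (k + 1) * ε`, strict below as the threshold requires; then
    -- `F i y ≥ (k - 1) * ε`, whence the bound `2 * ε`.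
    obtain ⟨k, hk⟩ : ∃ k, ⌈F i x / ε⌉₊ = k + 1 :=
      Nat.exists_eq_succ_of_ne_zero (Nat.ceil_pos.2 (div_pos h0 hε)).ne'
    have hk1 : (k : ℝ) < F i x / ε := Nat.lt_ceil.1 (by omega)
    have hk2 : F i x / ε ≤ k + 1 := by
      have := Nat.le_ceil (F i x / ε)
      rw [hk] at this
      exact_mod_cast this
    have hkm : k < m := by
      have h1 : F i x / ε ≤ 1 / ε := by gcongr; exact (h01 i x).2
      exact_mod_cast (hk1.trans_le h1).trans hm
    rw [lt_div_iff₀ hε] at hk1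
    rw [div_le_iff₀ hε] at hk2
    have := hUR (π i, k) (by simp [hkm]) x hx y hy i rfl hk1
    dsimp only at this
    linarith
  exact ⟨U, hUo, hU, fun x hx y hy i =>
    abs_sub_le_iff.2 ⟨key x hx y hy i, key y hy x hx i⟩⟩

/-! ### Almost increasing functions and their quotients -/

theorem baireDist_nonneg (σ τ : ℕ → ℕ) : 0 ≤ baireDist σ τ := by
  unfold baireDist
  split_ifs <;> positivity

theorem baireDist_le_of_agree {σ τ : ℕ → ℕ} {n : ℕ} (h : ∀ i < n, σ i = τ i) :
    baireDist σ τ ≤ 2 * (1 / 2 : ℝ) ^ n := by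
  unfold baireDist
  split_ifs with hst
  · positivity
  · have hne : {i | σ i ≠ τ i}.Nonempty := Function.ne_iff.1 hst
    have hn : n ≤ sInf {i | σ i ≠ τ i} :=
      le_csInf hne fun i hi => not_lt.1 fun hlt => hi (h i hlt)
    rw [zpow_sub₀ two_ne_zero, zpow_natCast, zpow_one, one_div_div, div_eq_mul_inv, ← inv_pow,
      one_div]
    gcongr 2 * ?_
    exact pow_le_pow_of_le_one (by norm_num) (by norm_num) hn

theorem compactSpace_almostIncreasing (r : (ℕ → ℕ) → (ℕ → ℕ) → Prop) :
    CompactSpace (almostIncreasing r) := by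
  rw [← isCompact_iff_compactSpace]
  have hcpt : IsCompact (Set.univ.pi fun _ : ℕ → ℕ => Set.Icc (0 : ℝ) 1) :=
    isCompact_univ_pi fun _ => isCompact_Icc
  refine hcpt.of_isClosed_subset ?_ fun x hx σ _ => hx.1 σ
  have h1 : IsClosed {x : (ℕ → ℕ) → ℝ | ∀ σ, x σ ∈ Set.Icc (0 : ℝ) 1} := by
    simp only [Set.ofPred_forall]
    exact isClosed_iInter fun σ => isClosed_Icc.preimage (continuous_apply σ)
  have h2 : IsClosed {x : (ℕ → ℕ) → ℝ | ∀ σ τ, r σ τ → x σ ≤ x τ + baireDist σ τ} := by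
    simp only [Set.ofPred_forall]
    exact isClosed_iInter fun σ => isClosed_iInter fun τ => isClosed_iInter fun _ =>
      isClosed_le (continuous_apply σ) ((continuous_apply τ).add continuous_const)
  exact h1.inter h2

/-- A compact space of functions with values in `[0,1]` is Radon-Nikodym if it is fragmented by the
uniform metric. -/
theorem isRNCompact_of_uniform {I : Type*} [Nonempty I] (L : Set (I → ℝ)) [CompactSpace L]
    (h01 : ∀ x ∈ L, ∀ i, x i ∈ Set.Icc (0 : ℝ) 1)
    (hfrag : ∀ ε > 0, ∀ Z : Set L, Z.Nonempty → ∃ U, IsOpen U ∧ (Z ∩ U).Nonempty ∧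
      ∀ x ∈ Z ∩ U, ∀ y ∈ Z ∩ U, ∀ i, |x.1 i - y.1 i| ≤ ε) : IsRNCompact L := by
  have hb : ∀ x y : L, BddAbove (Set.range fun i => |x.1 i - y.1 i|) := by
    rintro x y
    refine ⟨1, ?_⟩
    rintro _ ⟨i, rfl⟩
    have hx := h01 x.1 x.2 i
    have hy := h01 y.1 y.2 i
    exact abs_sub_le_iff.2 ⟨by linarith [hx.2, hy.1], by linarith [hy.2, hx.1]⟩
  refine ⟨inferInstance, inferInstance, fun x y => ⨆ i, |x.1 i - y.1 i|, ⟨?_, ?_, ?_⟩, ?_, ?_⟩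
  · refine fun x y => ⟨fun h => ?_, ?_⟩
    · ext i
      have := le_ciSup (hb x y) i
      rw [h] at this
      exact sub_eq_zero.1 (abs_nonpos_iff.1 this)
    · rintro rfl
      simp
  · intro x y
    simp only [abs_sub_comm]
  · refine fun x y z => ciSup_le fun i => (abs_sub_le _ (y.1 i) _).trans ?_
    exact add_le_add (le_ciSup (hb x y) i) (le_ciSup (hb y z) i)
  · refine lowerSemicontinuous_ciSup (fun p => hb p.1 p.2) fun i => Continuous.lowerSemicontinuous ?_
    have hcont : Continuous fun x : L => x.1 i :=
      (continuous_apply i).comp continuous_subtype_val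
    exact ((hcont.comp continuous_fst).sub (hcont.comp continuous_snd)).abs
  · intro ε hε Z hZ
    obtain ⟨U, hUo, hU, hUd⟩ := hfrag (ε / 2) (half_pos hε) Z hZ
    exact ⟨U, hUo, hU, ε / 2, half_lt_self hε, fun x hx y hy => ciSup_le (hUd x hx y hy)⟩

/-- Restricting the almost increasing functions to a subset of the Cantor space gives a
Radon-Nikodym quotient, whose weight is the size of that subset. -/
theorem hasRNQuotientOfWeight_of_le_continuum (r : (ℕ → ℕ) → (ℕ → ℕ) → Prop)
    (hr : IsWellOrder (ℕ → ℕ) r) {κ : Cardinal.{0}} (hκ : ℵ₀ ≤ κ) (hκc : κ ≤ 𝔠) :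
    HasRNQuotientOfWeight (almostIncreasing r) κ := by
  classical
  obtain ⟨S, rfl⟩ := le_mk_iff_exists_set.1 (show κ ≤ #(ℕ → Bool) by simpa using hκc)
  have : Infinite S := infinite_iff.2 hκ
  let e : S → ℕ → ℕ := fun a n => (a.1 n).toNat
  have he : Function.Injective e := fun a b h => Subtype.ext <| funext fun n =>
    (by decide : Function.Injective Bool.toNat) (congrFun h n)
  let rS : S → S → Prop := e ⁻¹'o r
  have : IsWellOrder S rS := (RelEmbedding.preimage ⟨e, he⟩ r).isWellOrder
  have := compactSpace_almostIncreasing r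
  let q₀ : almostIncreasing r → S → ℝ := fun x a => x.1 (e a)
  have hq₀ : Continuous q₀ :=
    continuous_pi fun a => (continuous_apply (e a)).comp continuous_subtype_val
  have : CompactSpace (Set.range q₀) := isCompact_iff_compactSpace.1 (isCompact_range hq₀)
  have h01 : ∀ x ∈ Set.range q₀, ∀ i, x i ∈ Set.Icc (0 : ℝ) 1 := by
    rintro _ ⟨x, rfl⟩ i
    exact x.2.1 (e i)
  refine ⟨Set.range q₀, inferInstance, Set.rangeFactorization q₀,
    .of_surjective_continuous Set.rangeFactorization_surjective (hq₀.subtype_mk _), ?_, ?_⟩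
  · refine isRNCompact_of_uniform _ h01 fun ε hε Z hZ => ?_
    -- With `ε / 4`, a common prefix of length `n` forces distance at most `2 * (1 / 2) ^ n < ε /
    -- 2`; the oscillation bound doubles this to `ε`.
    obtain ⟨n, hn⟩ := exists_pow_lt_of_lt_one (show 0 < ε / 4 by positivity)
      (show (1 / 2 : ℝ) < 1 by norm_num)
    obtain ⟨U, hUo, hU, hUd⟩ := exists_open_uniform_oscillation rS
      (fun i (x : Set.range q₀) => x.1 i)
      (fun i => (continuous_apply i).comp continuous_subtype_val) (fun i x => h01 x.1 x.2 i)
      (fun (a : S) (k : Fin n) => a.1 k) (ε / 2) (half_pos hε) (by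
        rintro ⟨_, x, rfl⟩ σ τ hστ hlt
        have hd : baireDist (e σ) (e τ) ≤ 2 * (1 / 2 : ℝ) ^ n :=
          baireDist_le_of_agree fun i hi => congrArg Bool.toNat (congrFun hστ ⟨i, hi⟩)
        have := x.2.2 _ _ hlt
        dsimp only [q₀]
        linarith) Z hZ
    exact ⟨U, hUo, hU, fun x hx y hy i => by linarith [hUd x hx y hy i]⟩
  · refine le_antisymm (topWeight_le_of_isInducing (IsInducing.subtypeVal)) ?_
    -- The indicator of the final segment from `τ` on is truly increasing, hence almost increasing.
    let step : (ℕ → ℕ) → (ℕ → ℕ) → ℝ := fun τ σ => if r σ τ then 0 else 1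
    have hstep : ∀ τ, step τ ∈ almostIncreasing r := by
      refine fun τ => ⟨fun σ => ?_, fun σ σ' hσ => ?_⟩
      · dsimp only [step]
        split_ifs <;> simp
      · have := baireDist_nonneg σ σ'
        dsimp only [step]
        split_ifs with h1 h2 h2
        · linarith
        · linarith
        · exact absurd (_root_.trans hσ h2) h1
        · linarith
    -- If `e a` precedes `e b`, the step at `e b` vanishes at `e a` and so misses the open set of
    -- `a`.
    refine le_topWeight_of_separated (X := Set.range q₀)
      (fun a => ⟨_, ⟨step (e a), hstep (e a)⟩, rfl⟩) (fun a => {x | 1 / 2 < x.1 a})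
      (fun a => isOpen_lt continuous_const ((continuous_apply a).comp continuous_subtype_val))
      (fun a => ?_) fun a b hab => ?_
    · have : ¬ r (e a) (e a) := irrefl_of r _
      simp only [q₀, step, Set.mem_ofPred_eq, if_neg this]
      norm_num
    · simp only [q₀, step, Set.mem_ofPred_eq]
      rcases trichotomous_of r (e a) (e b) with h | h | h
      · right
        rw [if_pos h]
        norm_num
      · exact absurd (he h) hab
      · left
        rw [if_pos h]
        norm_num

theorem theorem6 (r : (ℕ → ℕ) → (ℕ → ℕ) → Prop) (hr : IsWellOrder (ℕ → ℕ) r) :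
    (∀ κ : Cardinal.{0}, ℵ₀ ≤ κ → κ < 𝔠 → HasRNQuotientOfWeight (almostIncreasing r) κ) ∧
    (Cardinal.IsRegular (𝔠 : Cardinal.{0}) → HasRNQuotientOfWeight (almostIncreasing r) 𝔠) ∧
    ((∀ a b : ℕ → ℕ, {τ | r a τ ∧ r τ b}.Infinite → Dense {τ | r a τ ∧ r τ b}) →
      HasRNQuotientOfWeight (almostIncreasing r) 𝔠) := by
  exact ⟨fun κ hκ hκc => hasRNQuotientOfWeight_of_le_continuum r hr hκ hκc.le,
    fun _ => hasRNQuotientOfWeight_of_le_continuum r hr aleph0_le_continuum le_rfl,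
    fun _ => hasRNQuotientOfWeight_of_le_continuum r hr aleph0_le_continuum le_rfl⟩
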